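/- For $\alpha,\beta\in\mathbb R$ put $\rho:=\alpha+\beta+1$. For $\alpha>-1$, $\mu\in\mathbb C$ and $t\ge 0$ let $$\varphi_\mu^{(\alpha,\beta)}(t):={}_2F_1\Bigl(\tfrac{\rho-i\mu}{2},\tfrac{\rho+i\mu}{2};\alpha+1;-\sinh^2 t\Bigr)$$ be the Jacobi function, where ${}_2F_1(a,b;c;\cdot)$ denotes the principal branch of the Gauss hypergeometric function, i.e. the analytic continuation of the hypergeometric series to $\mathbb C\setminus[1,\infty)$, and let $$j_\alpha(x):={}_0F_1(\alpha+1;-x^2/4)=\Gamma(\alpha+1)\sum_{k=0}^\infty\frac{(-1)^k(x/2)^{2k}}{k!\,\Gamma(k+\alpha+1)}\qquad(x\in\mathbb R)$$ be the normalized Bessel function. Let $\alpha\ge\beta\ge-1/2$ with $\alpha>-1/2$, and let $T>0$. Then there exists a constant $C=C(\alpha,\beta,T)$ such that for all $\lambda\in\mathbb R$, all $t\in[0,T]$ and all real $n\ge 1$ (in particular for all positive integers $n$), $$\bigl|\varphi_{i\rho-n\lambda}^{(\alpha,\beta)}(t/n)-j_\alpha(\lambda t)\bigr|\le C\,\frac{|\lambda|\,t^2}{n}.$$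 -/

import Mathlib

open scoped Topology

/-- `F` is an analytic function on the open set `U`, star-shaped about `0`, and near `0` it is the
sum of the Gauss hypergeometric series with parameters `a, b; c`. -/
structure IsHypergeometricContinuation (a b c : ℂ) (U : Set ℂ) (F : ℂ → ℂ) : Prop where
  isOpen : IsOpen U
  zero_mem : (0 : ℂ) ∈ U
  starConvex : StarConvex ℝ 0 U
  analytic : AnalyticOnNhd ℂ F U
  germ : F =ᶠ[𝓝 0] ordinaryHypergeometric (𝔸 := ℂ) a b c

open Classical in
/-- The (principal branch of the) Gauss hypergeometric function `₂F₁(a, b; c; z)`: the value at `z`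
of the analytic continuation of the hypergeometric series along the segment from `0` to `z`. The
value does not depend on the choice (see `gaussHypergeometric_eq`), and is set to `0` if there is no
such continuation. -/
noncomputable def gaussHypergeometric (a b c z : ℂ) : ℂ :=
  if h : ∃ w : ℂ, ∃ U : Set ℂ, ∃ F : ℂ → ℂ, IsHypergeometricContinuation a b c U F ∧ z ∈ U ∧ F z = w
  then h.choose else 0

/-- Any analytic continuation to a star-shaped neighbourhood of `0` containing `z` computes the
value. -/
theorem gaussHypergeometric_eq {a b c z : ℂ} {U : Set ℂ} {F : ℂ → ℂ}
    (hF : IsHypergeometricContinuation a b c U F) (hz : z ∈ U) :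
    gaussHypergeometric a b c z = F z := by
  have h : ∃ w : ℂ, ∃ U : Set ℂ, ∃ F : ℂ → ℂ,
      IsHypergeometricContinuation a b c U F ∧ z ∈ U ∧ F z = w := ⟨_, U, F, hF, hz, rfl⟩
  rw [gaussHypergeometric, dif_pos h]
  obtain ⟨V, G, hG, hzV, hGz⟩ := h.choose_spec
  rw [← hGz]
  have hpre : IsPreconnected (V ∩ U) :=
    ((hG.starConvex.inter hF.starConvex).isPathConnected
      ⟨hG.zero_mem, hF.zero_mem⟩).isConnected.isPreconnected
  exact (hG.analytic.mono Set.inter_subset_left).eqOn_of_preconnected_of_eventuallyEq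
    (hF.analytic.mono Set.inter_subset_right) hpre ⟨hG.zero_mem, hF.zero_mem⟩
    (hG.germ.trans hF.germ.symm) ⟨hzV, hz⟩

/-- In the open unit disc the function is the sum of the hypergeometric series. -/
theorem gaussHypergeometric_eq_of_norm_lt_one (a b c : ℂ) {z : ℂ} (hz : ‖z‖ < 1) :
    gaussHypergeometric a b c z = ordinaryHypergeometric a b c z := by
  have hr : 1 ≤ (ordinaryHypergeometricSeries ℂ a b c).radius := by
    by_cases h : ∀ k : ℕ, (k : ℂ) ≠ -a ∧ (k : ℂ) ≠ -b ∧ (k : ℂ) ≠ -c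
    · exact (ordinaryHypergeometricSeries_radius_eq_one ℂ a b c h).ge
    · push Not at h
      obtain ⟨k, hk⟩ := h
      by_cases h1 : (k : ℂ) = -a
      · obtain rfl : a = -(k : ℂ) := by rw [h1, neg_neg]
        simp [ordinaryHypergeometric_radius_top_of_neg_nat₁]
      by_cases h2 : (k : ℂ) = -b
      · obtain rfl : b = -(k : ℂ) := by rw [h2, neg_neg]
        simp [ordinaryHypergeometric_radius_top_of_neg_nat₂]
      · obtain rfl : c = -(k : ℂ) := by rw [hk h1 h2, neg_neg]
        simp [ordinaryHypergeometric_radius_top_of_neg_nat₃]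
  have hball : HasFPowerSeriesOnBall (ordinaryHypergeometric (𝔸 := ℂ) a b c)
      (ordinaryHypergeometricSeries ℂ a b c) 0 1 :=
    ((ordinaryHypergeometricSeries ℂ a b c).hasFPowerSeriesOnBall
      (lt_of_lt_of_le zero_lt_one hr)).mono zero_lt_one hr
  refine gaussHypergeometric_eq (U := Metric.ball 0 1)
    ⟨Metric.isOpen_ball, by simp, (convex_ball 0 1).starConvex (by simp), ?_, .rfl⟩ (by simpa using hz)
  intro w hw
  refine hball.analyticAt_of_mem ?_
  have : (1 : ENNReal) = ENNReal.ofReal 1 := by simp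
  rw [this, Metric.eball_ofReal]
  exact hw

/-- The Jacobi function `φ_μ^{(α,β)}(t)` with spectral parameter `μ ∈ ℂ`. -/
noncomputable def jacobiFunction (α β : ℝ) (μ : ℂ) (t : ℝ) : ℂ :=
  gaussHypergeometric ((α + β + 1 - Complex.I * μ) / 2) ((α + β + 1 + Complex.I * μ) / 2)
    (α + 1) (-((Real.sinh t ^ 2 : ℝ) : ℂ))

/-- The normalized Bessel function `j_α(x) = ₀F₁(α + 1; -x² / 4)`, with `j_α(0) = 1`. -/
noncomputable def normalizedBessel (α x : ℝ) : ℝ :=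
  Real.Gamma (α + 1) *
    ∑' k : ℕ, (-1) ^ k * (x / 2) ^ (2 * k) / ((k.factorial : ℝ) * Real.Gamma (k + α + 1))

/-! Put `Λ = nλ`, `s = t/n`, `μ = iρ - Λ`. In the variable `s` the Jacobi function solves `u'' + p
u' + (μ² + ρ²) u = 0`, where `p` is the logarithmic derivative of `sinh^(2α+1) cosh^(2β+1)`, and `μ²
+ ρ² = Λ² - 2iρΛ`. The Bessel function `y(s) = j_α(Λs)` solves `y'' + ((2α+1)/s) y' + Λ² y = 0`.
Both are `1` with zero slope at `s = 0`. The difference `w = u - y` therefore starts from rest and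
solves the Jacobi equation with force `-(p - (2α+1)/s) y' + 2iρΛ y`. Since `0 ≤ p - (2α+1)/s ≤ 2ρ`,
`|y'| ≤ |Λ|` and `|Λ y| ≤ |Λ|`, the force is at most `4ρ|Λ|`. The energy `|w'|² + Λ²|w|²` then
yields `|w| = O(|Λ| s²) = O(|λ| t²/n)` (`norm_le_of_damped_oscillator`,
`norm_pfaff_sub_besselEntire_le`). The Jacobi equation is needed at every `-sinh² s`, beyond the
disc of convergence. Pfaff's formula gives the continuation to `Re z < 1/2`; it is identified with
the series because the hypergeometric equation has only one analytic solution with value `1` at `0`.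
-/

/-! ### Energy estimates for damped oscillators -/

/-- Energy estimate for a damped oscillator with complex frequency. -/
theorem energy_le_of_damped_oscillator {m ρ Λ K : ℝ} (hm : 0 < m) (hρ : 0 ≤ ρ)
    {w w₁ w₂ f : ℝ → ℂ} {p : ℝ → ℝ} (hw : ∀ s, HasDerivAt w (w₁ s) s)
    (hw₁ : ∀ s, HasDerivAt w₁ (w₂ s) s) (hp : ∀ s, 0 < s → m / s ≤ p s)
    (hf : ∀ s, 0 < s → ‖f s‖ ≤ K)
    (hode : ∀ s : ℝ, 0 < s →
      w₂ s + p s * w₁ s + ((Λ : ℂ) ^ 2 - 2 * Complex.I * ρ * Λ) * w s = f s)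
    {s : ℝ} (hs : 0 ≤ s) :
    ‖w₁ s‖ ^ 2 + Λ ^ 2 * ‖w s‖ ^ 2 ≤
      Real.exp (2 * ρ * s) *
        (‖w₁ 0‖ ^ 2 + Λ ^ 2 * ‖w 0‖ ^ 2 + s ^ 2 * K ^ 2 / (4 * m)) := by
  set E : ℝ → ℝ := fun s => ‖w₁ s‖ ^ 2 + Λ ^ 2 * ‖w s‖ ^ 2 with hE
  set E' : ℝ → ℝ := fun s => 2 * inner ℝ (w₁ s) (w₂ s) + Λ ^ 2 * (2 * inner ℝ (w s) (w₁ s)) with hE'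
  have hEd : ∀ s, HasDerivAt E (E' s) s := fun s =>
    ((hw₁ s).norm_sq).add (((hw s).norm_sq).const_mul (Λ ^ 2))
  have hbound : ∀ s, 0 < s → E' s ≤ 2 * ρ * E s + s * K ^ 2 / (2 * m) := by
    intro s hs
    have h2 : w₂ s = f s - (p s) • w₁ s - (Λ ^ 2) • w s + (2 * Complex.I * ρ * Λ) * w s := by
      rw [← hode s hs]; simp only [Complex.real_smul]; push_cast; ring
    -- The term `-Λ² ⟨w, w'⟩` cancels the derivative of `Λ²‖w‖²` in `E'`; damping, force and the
    -- imaginary part of the frequency remain.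
    have h3 : inner ℝ (w₁ s) (w₂ s) = inner ℝ (w₁ s) (f s) - p s * ‖w₁ s‖ ^ 2
        - Λ ^ 2 * inner ℝ (w s) (w₁ s) + inner ℝ (w₁ s) ((2 * Complex.I * ρ * Λ) * w s) := by
      rw [h2, inner_add_right, inner_sub_right, inner_sub_right, real_inner_smul_right,
        real_inner_smul_right, real_inner_self_eq_norm_sq, real_inner_comm (w s) (w₁ s)]
    have h4 : inner ℝ (w₁ s) (f s) ≤ ‖w₁ s‖ * K :=
      (real_inner_le_norm _ _).trans (by gcongr; exact hf s hs)
    -- The imaginary part costs `2ρ|Λ|‖w‖‖w'‖ ≤ ρ E`; this is the source of the growth rate `2ρ`.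
    have h5 : inner ℝ (w₁ s) ((2 * Complex.I * ρ * Λ) * w s) ≤ ρ * E s := by
      refine (real_inner_le_norm _ _).trans ?_
      have : ‖(2 * Complex.I * ρ * Λ) * w s‖ = 2 * ρ * (|Λ| * ‖w s‖) := by
        simp [abs_of_nonneg hρ]; ring
      rw [this]
      have := two_mul_le_add_sq ‖w₁ s‖ (|Λ| * ‖w s‖)
      rw [mul_pow, sq_abs] at this
      have := mul_le_mul_of_nonneg_left this hρ
      simp only [hE]; linarith
    have h6 : m / s * ‖w₁ s‖ ^ 2 ≤ p s * ‖w₁ s‖ ^ 2 := by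
      gcongr; exact hp s hs
    -- Completing the square: the singular damping `m / s` absorbs the force.
    have h7 : 2 * (‖w₁ s‖ * K) ≤ 2 * (m / s * ‖w₁ s‖ ^ 2) + s * K ^ 2 / (2 * m) := by
      have : 2 * (m / s * ‖w₁ s‖ ^ 2) + s * K ^ 2 / (2 * m) - 2 * (‖w₁ s‖ * K)
        = (2 * m * ‖w₁ s‖ - s * K) ^ 2 / (2 * m * s) := by field_simp; ring
      have : 0 ≤ (2 * m * ‖w₁ s‖ - s * K) ^ 2 / (2 * m * s) := by positivity
      linarith
    simp only [hE', h3]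
    linarith
  -- Grönwall's integrating factor, minus the primitive of the force term `s K² / (2m)`; the factor
  -- `exp(-2ρs) ≤ 1` on that term is discarded.
  set D : ℝ → ℝ := fun s => E s * Real.exp (-(2 * ρ * s)) - s ^ 2 * K ^ 2 / (4 * m) with hD
  have hDd : ∀ s, HasDerivAt D (E' s * Real.exp (-(2 * ρ * s))
      + E s * (Real.exp (-(2 * ρ * s)) * (-(2 * ρ))) - s * K ^ 2 / (2 * m)) s := by
    intro s
    have h1 : HasDerivAt (fun s => -(2 * ρ * s)) (-(2 * ρ)) s := by
      convert! ((hasDerivAt_id s).const_mul (2 * ρ)).neg using 1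
      ring
    have h2 : HasDerivAt (fun s : ℝ => s ^ 2 * K ^ 2 / (4 * m)) (s * K ^ 2 / (2 * m)) s := by
      convert! ((hasDerivAt_pow 2 s).mul_const (K ^ 2)).div_const (4 * m) using 1
      push_cast; field_simp; ring
    exact ((hEd s).mul h1.exp).sub h2
  have hanti : AntitoneOn D (Set.Ici 0) := by
    refine antitoneOn_of_deriv_nonpos (convex_Ici 0)
      (fun s _ => (hDd s).continuousAt.continuousWithinAt)
      (fun s _ => (hDd s).differentiableAt.differentiableWithinAt) fun s hs => ?_
    rw [interior_Ici, Set.mem_Ioi] at hs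
    rw [(hDd s).deriv]
    have h1 := hbound s hs
    have h2 : Real.exp (-(2 * ρ * s)) ≤ 1 := Real.exp_le_one_iff.2 (by
      have : 0 ≤ 2 * ρ * s := by positivity
      linarith)
    have h3 : 0 ≤ s * K ^ 2 / (2 * m) := by positivity
    have h4 := mul_le_mul_of_nonneg_right h1 (Real.exp_pos (-(2 * ρ * s))).le
    have h5 := mul_le_mul_of_nonneg_left h2 h3
    linarith
  have h := hanti (Set.mem_Ici.2 le_rfl) (Set.mem_Ici.2 hs) hs
  have h0 : D 0 = E 0 := by simp [hD]
  have h1 : E s * Real.exp (-(2 * ρ * s)) ≤ E 0 + s ^ 2 * K ^ 2 / (4 * m) := by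
    rw [h0] at h; simp only [hD] at h; linarith
  have h2 := mul_le_mul_of_nonneg_left h1 (Real.exp_pos (2 * ρ * s)).le
  rwa [mul_left_comm, ← Real.exp_add, add_neg_cancel, Real.exp_zero, mul_one] at h2

/-- A damped oscillator at rest at time `0` that is driven by a bounded force. -/
theorem norm_le_of_damped_oscillator {m ρ Λ K : ℝ} (hm : 0 < m) (hρ : 0 ≤ ρ) (hK : 0 ≤ K)
    {w w₁ w₂ f : ℝ → ℂ} {p : ℝ → ℝ} (hw : ∀ s, HasDerivAt w (w₁ s) s)
    (hw₁ : ∀ s, HasDerivAt w₁ (w₂ s) s) (hp : ∀ s, 0 < s → m / s ≤ p s)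
    (hf : ∀ s, 0 < s → ‖f s‖ ≤ K)
    (hode : ∀ s : ℝ, 0 < s →
      w₂ s + p s * w₁ s + ((Λ : ℂ) ^ 2 - 2 * Complex.I * ρ * Λ) * w s = f s)
    (h0 : w 0 = 0) (h0' : w₁ 0 = 0) {s : ℝ} (hs : 0 ≤ s) :
    ‖w s‖ ≤ Real.exp (ρ * s) * K * s ^ 2 / (2 * √m) := by
  -- One bound for the velocity on all of `[0, s]`, already linear in `s`; the mean value inequality
  -- supplies the second factor `s`.
  have hbound : ∀ x ∈ Set.Ico 0 s, ‖w₁ x‖ ≤ Real.exp (ρ * s) * K * s / (2 * √m) := by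
    intro x hx
    have h := energy_le_of_damped_oscillator hm hρ hw hw₁ hp hf hode hx.1
    rw [h0, h0'] at h
    have hΛ : 0 ≤ Λ ^ 2 * ‖w x‖ ^ 2 := by positivity
    refine abs_le_of_sq_le_sq' ?_ (by positivity) |>.2
    calc ‖w₁ x‖ ^ 2 ≤ Real.exp (2 * ρ * x) * (x ^ 2 * K ^ 2 / (4 * m)) := by
          simp only [norm_zero] at h; linarith
      _ ≤ Real.exp (2 * ρ * s) * (s ^ 2 * K ^ 2 / (4 * m)) := by
          have := hx.1
          have := hx.2.le
          gcongr
      _ = _ := by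
          rw [div_pow, mul_pow, mul_pow, mul_pow, Real.sq_sqrt hm.le, ← Real.exp_nat_mul]
          push_cast; ring_nf
  have h := norm_image_sub_le_of_norm_deriv_right_le_segment
    (fun x _ => (hw x).continuousAt.continuousWithinAt)
    (fun x _ => (hw x).hasDerivWithinAt) hbound s ⟨hs, le_rfl⟩
  rw [h0] at h
  simp only [sub_zero] at h
  exact h.trans_eq (by ring)

/-! ### Taylor coefficients and differential operators -/

/-- The Taylor coefficients of `F` at `0`. -/
noncomputable def taylorCoeff (F : ℂ → ℂ) (k : ℕ) : ℂ := iteratedDeriv k F 0 / k.factorial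

theorem hasSum_taylorCoeff {F : ℂ → ℂ} {r : ℝ} (hF : DifferentiableOn ℂ F (Metric.ball 0 r))
    {z : ℂ} (hz : z ∈ Metric.ball 0 r) : HasSum (fun k => taylorCoeff F k * z ^ k) (F z) := by
  convert! Complex.hasSum_taylorSeries_on_ball hF hz using 2 with k
  simp only [taylorCoeff, sub_zero, smul_eq_mul]
  ring

theorem taylorCoeff_zero (F : ℂ → ℂ) : taylorCoeff F 0 = F 0 := by
  simp [taylorCoeff]

theorem taylorCoeff_deriv (F : ℂ → ℂ) (k : ℕ) :
    taylorCoeff (deriv F) k = (k + 1) * taylorCoeff F (k + 1) := by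
  have : ((k : ℂ) + 1) ≠ 0 := Nat.cast_add_one_ne_zero k
  have : (k.factorial : ℂ) ≠ 0 := Nat.cast_ne_zero.2 k.factorial_ne_zero
  rw [taylorCoeff, taylorCoeff, iteratedDeriv_succ', Nat.factorial_succ]
  push_cast
  field_simp

/-- Turns a differential equation near `0` into a recurrence for the coefficients. -/
theorem hasSum_coeff_unique {f g : ℕ → ℂ} {F : ℂ → ℂ}
    (hf : ∀ᶠ z in 𝓝 (0 : ℂ), HasSum (fun k => f k * z ^ k) (F z))
    (hg : ∀ᶠ z in 𝓝 (0 : ℂ), HasSum (fun k => g k * z ^ k) (F z)) : f = g := by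
  have key : ∀ f : ℕ → ℂ, (∀ᶠ z in 𝓝 (0 : ℂ), HasSum (fun k => f k * z ^ k) (F z)) →
      HasFPowerSeriesAt F (FormalMultilinearSeries.ofScalars ℂ f) 0 := by
    intro f hf
    rw [hasFPowerSeriesAt_iff]
    filter_upwards [hf] with z hz
    simpa [mul_comm] using hz
  exact FormalMultilinearSeries.ofScalars_series_injective ℂ ℂ
    ((key f hf).eq_formalMultilinearSeries (key g hg))

theorem hasSum_mul_left_of_shift {f g : ℕ → ℂ} {z S : ℂ} (h : HasSum (fun k => f k * z ^ k) S)
    (h0 : g 0 = 0) (hg : ∀ k, g (k + 1) = f k) : HasSum (fun k => g k * z ^ k) (z * S) := by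
  rw [← hasSum_nat_add_iff' 1]
  simp only [Finset.range_one, Finset.sum_singleton, h0, hg, zero_mul, sub_zero]
  convert! h.mul_left z using 2 with k
  ring

/-- The operator `z F'' + c F'` on Taylor series. -/
theorem hasSum_bessel_operator {F : ℂ → ℂ} {r : ℝ}
    (hF : DifferentiableOn ℂ F (Metric.ball 0 r)) (c : ℂ) {z : ℂ} (hz : z ∈ Metric.ball 0 r) :
    HasSum (fun k : ℕ => ((k + 1) * (c + k) * taylorCoeff F (k + 1)) * z ^ k)
      (z * deriv (deriv F) z + c * deriv F z) := by
  have h1 := hasSum_taylorCoeff (hF.deriv Metric.isOpen_ball) hz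
  have h2 := hasSum_taylorCoeff ((hF.deriv Metric.isOpen_ball).deriv Metric.isOpen_ball) hz
  have h3 := hasSum_mul_left_of_shift h2
    (g := fun k => k * ((k + 1) * taylorCoeff F (k + 1))) (by simp) (fun k => by
      simp only [taylorCoeff_deriv]; push_cast; ring)
  convert! h3.add (h1.mul_left c) using 2 with k
  rw [taylorCoeff_deriv]; ring

/-- The hypergeometric differential operator on Taylor series. -/
theorem hasSum_hypergeometric_operator {F : ℂ → ℂ} {r : ℝ}
    (hF : DifferentiableOn ℂ F (Metric.ball 0 r)) (a b c : ℂ) {z : ℂ}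
    (hz : z ∈ Metric.ball 0 r) :
    HasSum (fun k : ℕ => ((k + 1) * (c + k) * taylorCoeff F (k + 1)
        - (a + k) * (b + k) * taylorCoeff F k) * z ^ k)
      (z * (1 - z) * deriv (deriv F) z + (c - (a + b + 1) * z) * deriv F z - a * b * F z) := by
  have h0 := hasSum_taylorCoeff hF hz
  have h1 := hasSum_taylorCoeff (hF.deriv Metric.isOpen_ball) hz
  have h2 := hasSum_taylorCoeff ((hF.deriv Metric.isOpen_ball).deriv Metric.isOpen_ball) hz
  have h3 := hasSum_mul_left_of_shift h1 (g := fun k => k * taylorCoeff F k) (by simp)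
    (fun k => by rw [taylorCoeff_deriv]; push_cast; ring)
  have h4 := hasSum_mul_left_of_shift h2
    (g := fun k => k * ((k + 1) * taylorCoeff F (k + 1))) (by simp) (fun k => by
      simp only [taylorCoeff_deriv]; push_cast; ring)
  have h5 := hasSum_mul_left_of_shift h4 (g := fun k => (k - 1) * k * taylorCoeff F k) (by simp)
    (fun k => by push_cast; ring)
  convert! (hasSum_bessel_operator hF c hz).sub
    ((h5.add (h3.mul_left (a + b + 1))).add (h0.mul_left (a * b))) using 1
  · ext k; ring
  · ring

theorem differentiableOn_ofScalarsSum {f : ℕ → ℂ} {r : NNReal} (hr : 0 < r)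
    (h : r ≤ (FormalMultilinearSeries.ofScalars ℂ f).radius) :
    DifferentiableOn ℂ (FormalMultilinearSeries.ofScalarsSum (E := ℂ) f) (Metric.ball 0 r) := by
  have hr' : (0 : ENNReal) < r := by exact_mod_cast hr
  have := (((FormalMultilinearSeries.ofScalars ℂ f).hasFPowerSeriesOnBall
    (hr'.trans_le h)).mono hr' h).differentiableOn
  rwa [Metric.eball_coe] at this

theorem taylorCoeff_ofScalarsSum {f : ℕ → ℂ} {r : NNReal} (hr : 0 < r)
    (h : r ≤ (FormalMultilinearSeries.ofScalars ℂ f).radius) :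
    taylorCoeff (FormalMultilinearSeries.ofScalarsSum (E := ℂ) f) = f := by
  have hr' : (0 : ENNReal) < r := by exact_mod_cast hr
  refine hasSum_coeff_unique (F := FormalMultilinearSeries.ofScalarsSum (E := ℂ) f) ?_ ?_
  · filter_upwards [Metric.ball_mem_nhds 0 (NNReal.coe_pos.2 hr)] with z hz
    exact hasSum_taylorCoeff (differentiableOn_ofScalarsSum hr h) hz
  · have := ((FormalMultilinearSeries.ofScalars ℂ f).hasFPowerSeriesOnBall
      (hr'.trans_le h)).hasFPowerSeriesAt
    rw [hasFPowerSeriesAt_iff] at this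
    filter_upwards [this] with z hz
    simpa [mul_comm, FormalMultilinearSeries.ofScalarsSum] using hz

/-! ### The hypergeometric series and its differential equation -/

theorem one_le_radius_ordinaryHypergeometricSeries (a b : ℂ) {c : ℂ} (hc : ∀ k : ℕ, c + k ≠ 0) :
    1 ≤ (ordinaryHypergeometricSeries ℂ a b c).radius := by
  by_cases h : ∀ k : ℕ, (k : ℂ) ≠ -a ∧ (k : ℂ) ≠ -b ∧ (k : ℂ) ≠ -c
  · exact (ordinaryHypergeometricSeries_radius_eq_one ℂ a b c h).ge
  · push Not at h
    obtain ⟨k, hk⟩ := h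
    by_cases h1 : (k : ℂ) = -a
    · obtain rfl : a = -(k : ℂ) := by rw [h1, neg_neg]
      simp [ordinaryHypergeometric_radius_top_of_neg_nat₁]
    by_cases h2 : (k : ℂ) = -b
    · obtain rfl : b = -(k : ℂ) := by rw [h2, neg_neg]
      simp [ordinaryHypergeometric_radius_top_of_neg_nat₂]
    · exact absurd (by rw [hk h1 h2]; ring) (hc k)

theorem differentiableOn_ordinaryHypergeometric (a b : ℂ) {c : ℂ} (hc : ∀ k : ℕ, c + k ≠ 0) :
    DifferentiableOn ℂ (ordinaryHypergeometric (𝔸 := ℂ) a b c) (Metric.ball 0 1) :=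
  differentiableOn_ofScalarsSum (r := 1) one_pos
    (by exact_mod_cast one_le_radius_ordinaryHypergeometricSeries a b hc)

theorem taylorCoeff_ordinaryHypergeometric (a b : ℂ) {c : ℂ} (hc : ∀ k : ℕ, c + k ≠ 0) :
    taylorCoeff (ordinaryHypergeometric (𝔸 := ℂ) a b c) =
      ordinaryHypergeometricCoefficient a b c :=
  taylorCoeff_ofScalarsSum (r := 1) one_pos
    (by exact_mod_cast one_le_radius_ordinaryHypergeometricSeries a b hc)

theorem ordinaryHypergeometricCoefficient_succ (a b : ℂ) {c : ℂ} (hc : ∀ k : ℕ, c + k ≠ 0)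
    (k : ℕ) : (k + 1) * (c + k) * ordinaryHypergeometricCoefficient a b c (k + 1) =
      (a + k) * (b + k) * ordinaryHypergeometricCoefficient a b c k := by
  have h1 : ((k : ℂ) + 1) ≠ 0 := Nat.cast_add_one_ne_zero k
  have h2 := hc k
  simp only [ordinaryHypergeometricCoefficient, ascPochhammer_succ_eval, Nat.factorial_succ]
  push_cast
  rw [mul_inv, mul_inv]
  field_simp

/-- The hypergeometric differential equation in the unit disc. -/
theorem ordinaryHypergeometric_ode (a b : ℂ) {c : ℂ} (hc : ∀ k : ℕ, c + k ≠ 0) {z : ℂ}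
    (hz : z ∈ Metric.ball (0 : ℂ) 1) :
    z * (1 - z) * deriv (deriv (ordinaryHypergeometric (𝔸 := ℂ) a b c)) z
      + (c - (a + b + 1) * z) * deriv (ordinaryHypergeometric (𝔸 := ℂ) a b c) z
      - a * b * ordinaryHypergeometric a b c z = 0 := by
  refine (hasSum_hypergeometric_operator
    (differentiableOn_ordinaryHypergeometric a b hc) a b c hz).unique ?_
  convert! hasSum_zero using 2 with k
  rw [taylorCoeff_ordinaryHypergeometric a b hc, ordinaryHypergeometricCoefficient_succ a b hc,
    sub_self, zero_mul]

/-- The hypergeometric series is the only solution of the hypergeometric differential equation that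
is analytic at `0` and has the value `1` there. -/
theorem eventuallyEq_ordinaryHypergeometric {F : ℂ → ℂ} {a b c : ℂ} (hc : ∀ k : ℕ, c + k ≠ 0)
    {r : ℝ} (hr : 0 < r) (hF : DifferentiableOn ℂ F (Metric.ball 0 r)) (h0 : F 0 = 1)
    (hode : ∀ z ∈ Metric.ball (0 : ℂ) r, z * (1 - z) * deriv (deriv F) z
      + (c - (a + b + 1) * z) * deriv F z - a * b * F z = 0) :
    F =ᶠ[𝓝 0] ordinaryHypergeometric (𝔸 := ℂ) a b c := by
  have hrec : (fun k : ℕ => (k + 1) * (c + k) * taylorCoeff F (k + 1)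
        - (a + k) * (b + k) * taylorCoeff F k) = 0 := by
    refine hasSum_coeff_unique (F := 0) ?_ (by simp [hasSum_zero])
    filter_upwards [Metric.ball_mem_nhds 0 hr] with z hz
    have h := hasSum_hypergeometric_operator hF a b c hz
    rwa [hode z hz] at h
  have hcoeff : ∀ k, taylorCoeff F k = ordinaryHypergeometricCoefficient a b c k := by
    intro k
    induction k with
    | zero => simp [taylorCoeff_zero, h0, ordinaryHypergeometricCoefficient]
    | succ k ih =>
      -- This factor does not vanish, so the recurrence determines every coefficient from the first.
      have h1 : ((k : ℂ) + 1) * (c + k) ≠ 0 := mul_ne_zero (Nat.cast_add_one_ne_zero k) (hc k)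
      apply mul_left_cancel₀ h1
      rw [ordinaryHypergeometricCoefficient_succ a b hc, ← ih]
      simpa [sub_eq_zero] using congrFun hrec k
  filter_upwards [Metric.ball_mem_nhds 0 hr, Metric.ball_mem_nhds 0 one_pos] with z hz hz'
  have h := hasSum_taylorCoeff (differentiableOn_ordinaryHypergeometric a b hc) hz'
  rw [taylorCoeff_ordinaryHypergeometric a b hc, ← funext hcoeff] at h
  exact (hasSum_taylorCoeff hF hz).unique h

/-! ### The entire function `₀F₁` -/

/-- The coefficients of the hypergeometric series `₀F₁(c; y)`. -/
noncomputable def besselCoeff (c : ℝ) (k : ℕ) : ℂ :=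
  (Real.Gamma c / (k.factorial * Real.Gamma (k + c)) : ℝ)

theorem besselCoeff_succ {c : ℝ} (hc : 0 < c) (k : ℕ) :
    (k + 1) * (c + k) * besselCoeff c (k + 1) = besselCoeff c k := by
  have h1 : (k : ℝ) + c ≠ 0 := by positivity
  have h2 : Real.Gamma (k + c) ≠ 0 := (Real.Gamma_pos_of_pos (by positivity)).ne'
  have h3 : ((k + 1 : ℕ) : ℝ) + c = (k + c) + 1 := by push_cast; ring
  have h4 : (k : ℝ) + 1 ≠ 0 := by positivity
  have h5 : c + (k : ℝ) ≠ 0 := by positivity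
  simp only [besselCoeff]
  norm_cast
  rw [h3, Real.Gamma_add_one h1, Nat.factorial_succ]
  push_cast
  field_simp
  ring

theorem besselCoeff_ne_zero {c : ℝ} (hc : 0 < c) (k : ℕ) : besselCoeff c k ≠ 0 := by
  have h2 : 0 < Real.Gamma (k + c) := Real.Gamma_pos_of_pos (by positivity)
  have h3 : 0 < Real.Gamma c := Real.Gamma_pos_of_pos hc
  rw [besselCoeff, Complex.ofReal_ne_zero]
  positivity

theorem besselCoeff_zero {c : ℝ} (hc : 0 < c) : besselCoeff c 0 = 1 := by
  have h3 : Real.Gamma c ≠ 0 := (Real.Gamma_pos_of_pos hc).ne'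
  simp [besselCoeff, h3]

theorem radius_besselCoeff {c : ℝ} (hc : 0 < c) :
    (FormalMultilinearSeries.ofScalars ℂ (besselCoeff c)).radius = ⊤ := by
  refine FormalMultilinearSeries.ofScalars_radius_eq_top_of_tendsto ℂ _
    (Filter.Eventually.of_forall (besselCoeff_ne_zero hc)) ?_
  have h : ∀ k : ℕ, ‖besselCoeff c k.succ‖ / ‖besselCoeff c k‖ = 1 / (k + 1) * (c + k)⁻¹ := by
    intro k
    have h1 := besselCoeff_ne_zero hc (k + 1)
    have h2 : (0 : ℝ) < k + 1 := by positivity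
    have h3 : 0 < c + k := by positivity
    rw [← besselCoeff_succ hc k, norm_mul, norm_mul, Nat.succ_eq_add_one]
    have h4 : ‖(k : ℂ) + 1‖ = k + 1 := by
      exact_mod_cast Complex.norm_of_nonneg h2.le
    have h5 : ‖(c : ℂ) + k‖ = c + k := by
      exact_mod_cast Complex.norm_of_nonneg h3.le
    rw [h4, h5]
    have := norm_ne_zero_iff.2 h1
    field_simp
  simp only [h]
  have h1 := tendsto_one_div_add_atTop_nhds_zero_nat (𝕜 := ℝ)
  have h2 : Filter.Tendsto (fun k : ℕ => (c + k)⁻¹) Filter.atTop (𝓝 0) :=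
    (Filter.tendsto_atTop_add_const_left _ c tendsto_natCast_atTop_atTop).inv_tendsto_atTop
  simpa using h1.mul h2

/-- The entire function `₀F₁(c; y)`. -/
noncomputable def besselEntire (c : ℝ) : ℂ → ℂ :=
  FormalMultilinearSeries.ofScalarsSum (E := ℂ) (besselCoeff c)

theorem differentiable_besselEntire {c : ℝ} (hc : 0 < c) : Differentiable ℂ (besselEntire c) := by
  intro z
  have h := differentiableOn_ofScalarsSum (f := besselCoeff c) (r := ‖z‖₊ + 1) (by positivity)
    (by simp [radius_besselCoeff hc])
  exact (h z (by simp)).differentiableAt (Metric.isOpen_ball.mem_nhds (by simp))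

theorem taylorCoeff_besselEntire {c : ℝ} (hc : 0 < c) :
    taylorCoeff (besselEntire c) = besselCoeff c :=
  taylorCoeff_ofScalarsSum (r := 1) one_pos (by simp [radius_besselCoeff hc])

theorem hasSum_besselEntire {c : ℝ} (hc : 0 < c) (y : ℂ) :
    HasSum (fun k => besselCoeff c k * y ^ k) (besselEntire c y) := by
  have h := hasSum_taylorCoeff (r := ‖y‖ + 1) (z := y)
    (differentiable_besselEntire hc).differentiableOn (by simp)
  rwa [taylorCoeff_besselEntire hc] at h

theorem besselEntire_zero {c : ℝ} (hc : 0 < c) : besselEntire c 0 = 1 := by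
  rw [← taylorCoeff_zero (besselEntire c), taylorCoeff_besselEntire hc, besselCoeff_zero hc]

/-- By `besselCoeff_succ`, the operator `y D² + c D` reproduces the series. -/
theorem besselEntire_ode {c : ℝ} (hc : 0 < c) (y : ℂ) :
    y * deriv (deriv (besselEntire c)) y + c * deriv (besselEntire c) y = besselEntire c y := by
  have h := hasSum_bessel_operator (r := ‖y‖ + 1) (z := y)
    (differentiable_besselEntire hc).differentiableOn c (by simp)
  simp only [taylorCoeff_besselEntire hc, besselCoeff_succ hc] at h
  exact h.unique (hasSum_besselEntire hc y)

theorem normalizedBessel_eq_besselEntire {α : ℝ} (hα : -1 < α) (x : ℝ) :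
    ((normalizedBessel α x : ℝ) : ℂ) = besselEntire (α + 1) (-((x : ℂ) ^ 2 / 4)) := by
  rw [normalizedBessel, Complex.ofReal_mul, Complex.ofReal_tsum, ← tsum_mul_left,
    ← (hasSum_besselEntire (by linarith : 0 < α + 1) _).tsum_eq]
  refine tsum_congr fun k => ?_
  have : -((x : ℂ) ^ 2 / 4) = -1 * (x / 2) ^ 2 := by ring
  rw [besselCoeff, this, mul_pow, ← pow_mul, ← add_assoc]
  push_cast
  ring

/-! ### Continuation to a half-plane by Pfaff's transformation -/

/-- The right-hand side of Pfaff's transformation of the hypergeometric function. -/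
noncomputable def pfaff (a b c z : ℂ) : ℂ :=
  (1 - z) ^ (-b) * ordinaryHypergeometric (𝔸 := ℂ) (c - a) b c (z / (z - 1))

/-- `Re z < 1/2` means that `z` is closer to `0` than to `1`. -/
theorem div_sub_one_mem_ball {z : ℂ} (hz : z.re < 1 / 2) :
    z / (z - 1) ∈ Metric.ball (0 : ℂ) 1 := by
  have h : z - 1 ≠ 0 := fun h => by
    rw [sub_eq_zero.1 h] at hz; norm_num at hz
  rw [mem_ball_zero_iff, norm_div, div_lt_one (norm_pos_iff.2 h)]
  refine lt_of_pow_lt_pow_left₀ 2 (norm_nonneg _) ?_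
  rw [← Complex.normSq_eq_norm_sq, ← Complex.normSq_eq_norm_sq, Complex.normSq_apply,
    Complex.normSq_apply]
  simp only [Complex.sub_re, Complex.sub_im, Complex.one_re, Complex.one_im]
  nlinarith

theorem one_sub_ne_zero_of_re_lt {z : ℂ} (hz : z.re < 1 / 2) : 1 - z ≠ 0 := fun h => by
  rw [← sub_eq_zero.1 h] at hz; norm_num at hz

theorem hasDerivAt_one_sub_cpow_neg (b : ℂ) {z : ℂ} (hz : z.re < 1 / 2) :
    HasDerivAt (fun z : ℂ => (1 - z) ^ (-b)) ((1 - z) ^ (-b) * (b / (1 - z))) z := by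
  have hs : 1 - z ∈ Complex.slitPlane := Or.inl (by
    simp only [Complex.sub_re, Complex.one_re]; linarith)
  convert! ((hasDerivAt_id z).const_sub 1).cpow_const (c := -b) hs using 1
  rw [id, Complex.cpow_sub _ _ (one_sub_ne_zero_of_re_lt hz), Complex.cpow_one]
  ring

theorem hasDerivAt_div_sub_one {z : ℂ} (hz : z.re < 1 / 2) :
    HasDerivAt (fun z : ℂ => z / (z - 1)) (-1 / (1 - z) ^ 2) z := by
  have h := one_sub_ne_zero_of_re_lt hz
  have h' : z - 1 ≠ 0 := by rwa [← neg_ne_zero, neg_sub]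
  convert! (hasDerivAt_id z).div ((hasDerivAt_id z).sub_const 1) h' using 1
  rw [id, ← neg_sub z 1]
  field_simp
  ring

theorem isOpen_re_lt_half : IsOpen {z : ℂ | z.re < 1 / 2} :=
  isOpen_lt Complex.continuous_re continuous_const

section

variable {a b c : ℂ} (hc : ∀ k : ℕ, c + k ≠ 0)
include hc

theorem hasDerivAt_pfaff {z : ℂ} (hz : z.re < 1 / 2) :
    HasDerivAt (pfaff a b c) ((1 - z) ^ (-b) *
      (b / (1 - z) * ordinaryHypergeometric (𝔸 := ℂ) (c - a) b c (z / (z - 1))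
        - deriv (ordinaryHypergeometric (𝔸 := ℂ) (c - a) b c) (z / (z - 1)) / (1 - z) ^ 2)) z := by
  have hw := div_sub_one_mem_ball hz
  have hG := ((differentiableOn_ordinaryHypergeometric (c - a) b hc).differentiableAt
    (Metric.isOpen_ball.mem_nhds hw)).hasDerivAt
  convert! (hasDerivAt_one_sub_cpow_neg b hz).mul (hG.comp z (hasDerivAt_div_sub_one hz)) using 1
  simp only [Function.comp]
  ring

theorem hasDerivAt_deriv_pfaff {z : ℂ} (hz : z.re < 1 / 2) :
    HasDerivAt (deriv (pfaff a b c)) ((1 - z) ^ (-b) *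
      (b * (b + 1) / (1 - z) ^ 2 * ordinaryHypergeometric (𝔸 := ℂ) (c - a) b c (z / (z - 1))
        - (2 * b + 2) / (1 - z) ^ 3 *
          deriv (ordinaryHypergeometric (𝔸 := ℂ) (c - a) b c) (z / (z - 1))
        + deriv (deriv (ordinaryHypergeometric (𝔸 := ℂ) (c - a) b c)) (z / (z - 1))
          / (1 - z) ^ 4)) z := by
  have hev : deriv (pfaff a b c) =ᶠ[𝓝 z] fun z => (1 - z) ^ (-b) *
      (b / (1 - z) * ordinaryHypergeometric (𝔸 := ℂ) (c - a) b c (z / (z - 1))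
        - deriv (ordinaryHypergeometric (𝔸 := ℂ) (c - a) b c) (z / (z - 1)) / (1 - z) ^ 2) := by
    filter_upwards [isOpen_re_lt_half.mem_nhds hz] with x hx
    exact (hasDerivAt_pfaff hc hx).deriv
  refine HasDerivAt.congr_of_eventuallyEq ?_ hev
  have hw := div_sub_one_mem_ball hz
  have hv := one_sub_ne_zero_of_re_lt hz
  have hD := differentiableOn_ordinaryHypergeometric (c - a) b hc
  have hG := (hD.differentiableAt (Metric.isOpen_ball.mem_nhds hw)).hasDerivAt.comp z
    (hasDerivAt_div_sub_one hz)
  have hG' := ((hD.deriv Metric.isOpen_ball).differentiableAt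
    (Metric.isOpen_ball.mem_nhds hw)).hasDerivAt.comp z (hasDerivAt_div_sub_one hz)
  have hid : HasDerivAt (fun z : ℂ => 1 - z) (-1) z := (hasDerivAt_id z).const_sub 1
  convert! (hasDerivAt_one_sub_cpow_neg b hz).mul
    ((((hasDerivAt_const z b).div hid hv).mul hG).sub (hG'.div (hid.pow 2) (pow_ne_zero 2 hv)))
    using 1
  simp only [Function.comp, Pi.div_apply, Pi.mul_apply, Pi.pow_apply, Pi.sub_apply]
  field_simp
  ring

theorem differentiableOn_pfaff : DifferentiableOn ℂ (pfaff a b c) {z : ℂ | z.re < 1 / 2} :=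
  fun _ hz => (hasDerivAt_pfaff hc hz).differentiableAt.differentiableWithinAt

theorem pfaff_ode {z : ℂ} (hz : z.re < 1 / 2) :
    z * (1 - z) * deriv (deriv (pfaff a b c)) z
      + (c - (a + b + 1) * z) * deriv (pfaff a b c) z - a * b * pfaff a b c z = 0 := by
  have hv := one_sub_ne_zero_of_re_lt hz
  have hode := ordinaryHypergeometric_ode (c - a) b hc (div_sub_one_mem_ball hz)
  rw [(hasDerivAt_pfaff hc hz).deriv, (hasDerivAt_deriv_pfaff hc hz).deriv, pfaff]
  generalize deriv (deriv (ordinaryHypergeometric (𝔸 := ℂ) (c - a) b c)) (z / (z - 1)) = G₂ at *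
  generalize deriv (ordinaryHypergeometric (𝔸 := ℂ) (c - a) b c) (z / (z - 1)) = G₁ at *
  generalize ordinaryHypergeometric (𝔸 := ℂ) (c - a) b c (z / (z - 1)) = G at *
  generalize (1 - z) ^ (-b) = P
  have hw : z / (z - 1) = 1 - 1 / (1 - z) := by
    rw [← neg_sub 1 z]; field_simp; ring
  rw [hw] at hode
  have hz' : z = 1 - (1 - z) := by ring
  generalize 1 - z = v at *
  subst hz'
  -- With `v = 1 - z` and `w = 1 - 1/v`, the operator with parameters `a, b, c` at `z` is `-(P/v)`
  -- times the operator with parameters `c - a, b, c` at `w`.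
  have : (1 - v) * v * (P * (b * (b + 1) / v ^ 2 * G - (2 * b + 2) / v ^ 3 * G₁ + G₂ / v ^ 4))
      + (c - (a + b + 1) * (1 - v)) * (P * (b / v * G - G₁ / v ^ 2)) - a * b * (P * G)
      = -(P / v) * ((1 - 1 / v) * (1 - (1 - 1 / v)) * G₂ + (c - (c - a + b + 1) * (1 - 1 / v)) * G₁
        - (c - a) * b * G) := by
    field_simp
    ring
  rw [this, hode, mul_zero]

/-- Near `0` the Pfaff expression solves the hypergeometric equation with value `1`, so
`eventuallyEq_ordinaryHypergeometric` identifies it with the series. -/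
theorem isHypergeometricContinuation_pfaff :
    IsHypergeometricContinuation a b c {z : ℂ | z.re < 1 / 2} (pfaff a b c) := by
  have hball : ∀ z ∈ Metric.ball (0 : ℂ) (1 / 2), z.re < 1 / 2 := fun z hz =>
    (Complex.re_le_norm z).trans_lt (by simpa using hz)
  refine ⟨isOpen_re_lt_half, by simp, ?_,
    (differentiableOn_pfaff hc).analyticOnNhd isOpen_re_lt_half, ?_⟩
  · exact (convex_halfSpace_re_lt (1 / 2)).starConvex (by simp)
  · exact eventuallyEq_ordinaryHypergeometric hc (r := 1 / 2) (by norm_num)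
      ((differentiableOn_pfaff hc).mono hball) (by simp [pfaff])
      fun z hz => pfaff_ode hc (hball z hz)

end

/-! ### Bounds for the damping coefficient -/

theorem sinh_le_mul_cosh {s : ℝ} (hs : 0 ≤ s) : Real.sinh s ≤ s * Real.cosh s := by
  have hd : ∀ x : ℝ, HasDerivAt (fun x => x * Real.cosh x - Real.sinh x) (x * Real.sinh x) x := by
    intro x
    convert! ((hasDerivAt_id x).mul (Real.hasDerivAt_cosh x)).sub (Real.hasDerivAt_sinh x) using 1
    simp
  have hmono : MonotoneOn (fun x => x * Real.cosh x - Real.sinh x) (Set.Ici 0) := by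
    refine monotoneOn_of_deriv_nonneg (convex_Ici 0)
      (fun x _ => (hd x).continuousAt.continuousWithinAt)
      (fun x _ => (hd x).differentiableAt.differentiableWithinAt) fun x hx => ?_
    rw [interior_Ici, Set.mem_Ioi] at hx
    rw [(hd x).deriv]
    exact mul_nonneg hx.le (Real.sinh_nonneg_iff.2 hx.le)
  have h := hmono (Set.mem_Ici.2 le_rfl) (Set.mem_Ici.2 hs) hs
  simp only [Real.sinh_zero, zero_mul, sub_zero] at h
  linarith

theorem one_div_le_cosh_div_sinh {s : ℝ} (hs : 0 < s) :
    1 / s ≤ Real.cosh s / Real.sinh s := by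
  rw [div_le_div_iff₀ hs (Real.sinh_pos_iff.2 hs), one_mul, mul_comm]
  exact sinh_le_mul_cosh hs.le

/-- Follows from `cosh s - sinh s = exp(-s) ≤ 1` and `1 ≤ sinh s / s`. -/
theorem cosh_div_sinh_le {s : ℝ} (hs : 0 < s) :
    Real.cosh s / Real.sinh s ≤ 1 / s + 1 := by
  have h1 : s ≤ Real.sinh s := Real.self_le_sinh_iff.2 hs.le
  have h2 : Real.cosh s - Real.sinh s ≤ 1 := by
    rw [Real.cosh_sub_sinh, Real.exp_le_one_iff]; linarith
  rw [div_le_iff₀ (Real.sinh_pos_iff.2 hs)]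
  have h3 : 1 ≤ 1 / s * Real.sinh s := by
    rw [one_div, inv_mul_eq_div, one_le_div hs]; exact h1
  linarith

theorem sinh_div_cosh_mem_Icc {s : ℝ} (hs : 0 < s) :
    Real.sinh s / Real.cosh s ∈ Set.Icc (0 : ℝ) 1 :=
  ⟨div_nonneg (Real.sinh_nonneg_iff.2 hs.le) (Real.cosh_pos s).le,
    (div_le_one (Real.cosh_pos s)).2 (Real.sinh_lt_cosh s).le⟩

/-- The logarithmic derivative of the weight `sinh ^ (2α + 1) * cosh ^ (2β + 1)`. -/
noncomputable def jacobiDamping (α β s : ℝ) : ℝ :=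
  (2 * α + 1) * (Real.cosh s / Real.sinh s) + (2 * β + 1) * (Real.sinh s / Real.cosh s)

theorem div_le_jacobiDamping {α β s : ℝ} (hα : -(1 / 2) < α) (hβ : -(1 / 2) ≤ β) (hs : 0 < s) :
    (2 * α + 1) / s ≤ jacobiDamping α β s := by
  have h1 := mul_le_mul_of_nonneg_left (one_div_le_cosh_div_sinh hs)
    (by linarith : 0 ≤ 2 * α + 1)
  have h2 := mul_nonneg (by linarith : 0 ≤ 2 * β + 1) (sinh_div_cosh_mem_Icc hs).1
  rw [jacobiDamping, div_eq_mul_one_div]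
  linarith

/-- The excess over `(2α+1)/s` is at most `(2α+1) + (2β+1) = 2ρ`. -/
theorem jacobiDamping_le {α β s : ℝ} (hα : -(1 / 2) < α) (hβ : -(1 / 2) ≤ β) (hs : 0 < s) :
    jacobiDamping α β s ≤ (2 * α + 1) / s + 2 * (α + β + 1) := by
  have h1 := mul_le_mul_of_nonneg_left (cosh_div_sinh_le hs) (by linarith : 0 ≤ 2 * α + 1)
  have h2 := mul_le_mul_of_nonneg_left (sinh_div_cosh_mem_Icc hs).2
    (by linarith : 0 ≤ 2 * β + 1)
  rw [jacobiDamping, div_eq_mul_one_div (2 * α + 1) s]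
  linarith

/-! ### Differential equations in the real variable `s` -/

section

variable {F F₁ F₂ : ℂ → ℂ}

theorem hasDerivAt_comp_neg_sinh_sq (hF : ∀ z : ℂ, z.re < 1 / 2 → HasDerivAt F (F₁ z) z) (s : ℝ) :
    HasDerivAt (fun s : ℝ => F (-Complex.sinh s ^ 2))
      (-(2 * Complex.sinh s * Complex.cosh s) * F₁ (-Complex.sinh s ^ 2)) s := by
  have hre : (-Complex.sinh s ^ 2).re < 1 / 2 := by
    rw [← Complex.ofReal_sinh, ← Complex.ofReal_pow, ← Complex.ofReal_neg, Complex.ofReal_re]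
    nlinarith [sq_nonneg (Real.sinh s)]
  have hz : HasDerivAt (fun ζ : ℂ => -Complex.sinh ζ ^ 2)
      (-(2 * Complex.sinh s * Complex.cosh s)) s := by
    convert! ((Complex.hasDerivAt_sinh (s : ℂ)).pow 2).neg using 1
    push_cast; ring
  convert! ((hF _ hre).comp (s : ℂ) hz).comp_ofReal using 1
  ring

theorem hasDerivAt_deriv_comp_neg_sinh_sq
    (hF₁ : ∀ z : ℂ, z.re < 1 / 2 → HasDerivAt F₁ (F₂ z) z) (s : ℝ) :
    HasDerivAt (fun s : ℝ => -(2 * Complex.sinh s * Complex.cosh s) * F₁ (-Complex.sinh s ^ 2))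
      (-(2 * (Complex.cosh s ^ 2 + Complex.sinh s ^ 2)) * F₁ (-Complex.sinh s ^ 2)
        + 4 * Complex.sinh s ^ 2 * Complex.cosh s ^ 2 * F₂ (-Complex.sinh s ^ 2)) s := by
  have h : HasDerivAt (fun s : ℝ => -(2 * Complex.sinh s * Complex.cosh s))
      (-(2 * (Complex.cosh s ^ 2 + Complex.sinh s ^ 2))) s := by
    have h' : HasDerivAt (fun ζ : ℂ => -(2 * Complex.sinh ζ * Complex.cosh ζ))
        (-(2 * (Complex.cosh s ^ 2 + Complex.sinh s ^ 2))) s := by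
      convert! (((Complex.hasDerivAt_sinh (s : ℂ)).const_mul 2).mul
        (Complex.hasDerivAt_cosh (s : ℂ))).neg using 1
      ring
    exact h'.comp_ofReal
  convert! h.mul (hasDerivAt_comp_neg_sinh_sq hF₁ s) using 1
  ring

/-- The substitution `z = -sinh² s` in the hypergeometric differential equation. -/
theorem jacobi_ode {a b κ f f₁ f₂ : ℂ} {α β s : ℝ} (hs : 0 < s) (hab : a + b = α + β + 1)
    (hκ : 4 * a * b = κ)
    (hode : -Complex.sinh s ^ 2 * (1 - -Complex.sinh s ^ 2) * f₂
      + (α + 1 - (a + b + 1) * -Complex.sinh s ^ 2) * f₁ - a * b * f = 0) :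
    (-(2 * (Complex.cosh s ^ 2 + Complex.sinh s ^ 2)) * f₁
        + 4 * Complex.sinh s ^ 2 * Complex.cosh s ^ 2 * f₂)
      + jacobiDamping α β s * (-(2 * Complex.sinh s * Complex.cosh s) * f₁) + κ * f = 0 := by
  have hS : Complex.sinh s ≠ 0 := by
    rw [← Complex.ofReal_sinh]; exact Complex.ofReal_ne_zero.2 (Real.sinh_pos_iff.2 hs).ne'
  have hC : Complex.cosh s ≠ 0 := by
    rw [← Complex.ofReal_cosh]; exact Complex.ofReal_ne_zero.2 (Real.cosh_pos s).ne'
  have hp : (jacobiDamping α β s : ℂ) * (Complex.sinh s * Complex.cosh s) =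
      (2 * α + 1) * Complex.cosh s ^ 2 + (2 * β + 1) * Complex.sinh s ^ 2 := by
    rw [jacobiDamping]; push_cast; field_simp
  have hCS := Complex.cosh_sq (s : ℂ)
  rw [hab] at hode
  -- `-4` times the hypergeometric equation, with `hp` clearing the denominators of the damping.
  linear_combination (-4) * hode - 2 * f₁ * hp
    + (-2 * f₁ + 4 * Complex.sinh s ^ 2 * f₂ - 2 * (2 * α + 1) * f₁) * hCS - f * hκ

end

theorem hasDerivAt_comp_neg_sq {H H₁ : ℂ → ℂ} (hH : ∀ z, HasDerivAt H (H₁ z) z) (Λ s : ℝ) :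
    HasDerivAt (fun s : ℝ => H (-(((Λ : ℂ) * s) ^ 2 / 4)))
      (-((Λ : ℂ) ^ 2 * s / 2) * H₁ (-(((Λ : ℂ) * s) ^ 2 / 4))) s := by
  have hz : HasDerivAt (fun ζ : ℂ => -(((Λ : ℂ) * ζ) ^ 2 / 4)) (-((Λ : ℂ) ^ 2 * s / 2)) s := by
    convert! ((((hasDerivAt_id (s : ℂ)).const_mul (Λ : ℂ)).pow 2).div_const 4).neg using 1
    simp only [id]; push_cast; ring
  convert! ((hH _).comp (s : ℂ) hz).comp_ofReal using 1
  ring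

theorem hasDerivAt_deriv_comp_neg_sq {H₁ H₂ : ℂ → ℂ} (hH₁ : ∀ z, HasDerivAt H₁ (H₂ z) z)
    (Λ s : ℝ) :
    HasDerivAt (fun s : ℝ => -((Λ : ℂ) ^ 2 * s / 2) * H₁ (-(((Λ : ℂ) * s) ^ 2 / 4)))
      (-((Λ : ℂ) ^ 2 / 2) * H₁ (-(((Λ : ℂ) * s) ^ 2 / 4))
        + (Λ : ℂ) ^ 4 * s ^ 2 / 4 * H₂ (-(((Λ : ℂ) * s) ^ 2 / 4))) s := by
  have h : HasDerivAt (fun s : ℝ => -((Λ : ℂ) ^ 2 * s / 2)) (-((Λ : ℂ) ^ 2 / 2)) s := by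
    have h' : HasDerivAt (fun ζ : ℂ => -((Λ : ℂ) ^ 2 * ζ / 2)) (-((Λ : ℂ) ^ 2 / 2)) s := by
      convert! (((hasDerivAt_id (s : ℂ)).const_mul ((Λ : ℂ) ^ 2)).div_const 2).neg using 1
      ring
    exact h'.comp_ofReal
  convert! h.mul (hasDerivAt_comp_neg_sq hH₁ Λ s) using 1
  ring

/-! ### Comparison of the two oscillators -/

theorem norm_pfaff_sub_besselEntire_le {α β Λ : ℝ} (hβ : -(1 / 2) ≤ β) (hα : -(1 / 2) < α)
    {a b : ℂ} (hab : a + b = α + β + 1)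
    (hκ : 4 * a * b = (Λ : ℂ) ^ 2 - 2 * Complex.I * (α + β + 1 : ℝ) * Λ) {s : ℝ} (hs : 0 ≤ s) :
    ‖pfaff a b (α + 1) (-Complex.sinh s ^ 2)
        - besselEntire (α + 1) (-(((Λ : ℂ) * s) ^ 2 / 4))‖ ≤
      Real.exp ((α + β + 1) * s) * (4 * (α + β + 1) * |Λ|) * s ^ 2 / (2 * √(2 * α + 1)) := by
  have hc' : 0 < α + 1 := by linarith
  have hc : ∀ k : ℕ, (α + 1 : ℂ) + k ≠ 0 := by
    intro k
    have : (0 : ℝ) < α + 1 + k := by positivity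
    exact_mod_cast this.ne'
  have hρ : 0 ≤ α + β + 1 := by linarith
  have hm : 0 < 2 * α + 1 := by linarith
  have hF : ∀ z : ℂ, z.re < 1 / 2 → HasDerivAt (pfaff a b (α + 1)) (deriv (pfaff a b (α + 1)) z) z :=
    fun z hz => (hasDerivAt_pfaff hc hz).differentiableAt.hasDerivAt
  have hF₁ : ∀ z : ℂ, z.re < 1 / 2 →
      HasDerivAt (deriv (pfaff a b (α + 1))) (deriv (deriv (pfaff a b (α + 1))) z) z :=
    fun z hz => (hasDerivAt_deriv_pfaff hc hz).differentiableAt.hasDerivAt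
  have hD := differentiable_besselEntire hc'
  have hH : ∀ z, HasDerivAt (besselEntire (α + 1)) (deriv (besselEntire (α + 1)) z) z :=
    fun z => (hD z).hasDerivAt
  have hH₁ : ∀ z, HasDerivAt (deriv (besselEntire (α + 1)))
      (deriv (deriv (besselEntire (α + 1))) z) z :=
    fun z => (hD.deriv z).hasDerivAt
  have hu := hasDerivAt_comp_neg_sinh_sq hF
  have hu₁ := hasDerivAt_deriv_comp_neg_sinh_sq hF₁
  have hy := hasDerivAt_comp_neg_sq hH Λ
  have hy₁ := hasDerivAt_deriv_comp_neg_sq hH₁ Λ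
  have hyode : ∀ s : ℝ, 0 < s →
      (-((Λ : ℂ) ^ 2 / 2) * deriv (besselEntire (α + 1)) (-(((Λ : ℂ) * s) ^ 2 / 4))
        + (Λ : ℂ) ^ 4 * s ^ 2 / 4 * deriv (deriv (besselEntire (α + 1))) (-(((Λ : ℂ) * s) ^ 2 / 4)))
      + ((2 * α + 1) / s : ℝ) * (-((Λ : ℂ) ^ 2 * s / 2) *
        deriv (besselEntire (α + 1)) (-(((Λ : ℂ) * s) ^ 2 / 4)))
      + (Λ : ℂ) ^ 2 * besselEntire (α + 1) (-(((Λ : ℂ) * s) ^ 2 / 4)) = 0 := by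
    intro s hs
    have h := besselEntire_ode hc' (-(((Λ : ℂ) * s) ^ 2 / 4))
    have hs' : (s : ℂ) ≠ 0 := Complex.ofReal_ne_zero.2 hs.ne'
    have hq : (((2 * α + 1) / s : ℝ) : ℂ) * s = 2 * α + 1 := by
      push_cast; field_simp
    push_cast at h hq ⊢
    linear_combination (-(Λ : ℂ) ^ 2) * h - (Λ : ℂ) ^ 2 / 2 *
      deriv (besselEntire (α + 1)) (-(((Λ : ℂ) * s) ^ 2 / 4)) * hq
  set y : ℝ → ℂ := fun s => besselEntire (α + 1) (-(((Λ : ℂ) * s) ^ 2 / 4)) with hydef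
  set y₁ : ℝ → ℂ := fun s =>
    -((Λ : ℂ) ^ 2 * s / 2) * deriv (besselEntire (α + 1)) (-(((Λ : ℂ) * s) ^ 2 / 4)) with hy₁def
  have hy0 : y 0 = 1 := by simp [hydef, besselEntire_zero hc']
  have hy₁0 : y₁ 0 = 0 := by simp [hy₁def]
  -- The unforced estimate with growth rate `0`: the Bessel energy never exceeds its initial value
  -- `Λ²`.
  have henergy : ∀ s : ℝ, 0 < s → ‖y₁ s‖ ^ 2 + Λ ^ 2 * ‖y s‖ ^ 2 ≤ Λ ^ 2 := by
    intro s hs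
    have h := energy_le_of_damped_oscillator (ρ := 0) (Λ := Λ) (K := 0) (f := 0)
      (w₁ := y₁) (p := fun s => (2 * α + 1) / s) hm le_rfl hy hy₁ (fun _ _ => le_rfl)
      (fun _ _ => by simp) (fun s hs => by simpa [hydef, hy₁def] using hyode s hs) hs.le
    rw [hy0, hy₁0] at h
    simpa using h
  have hy₁le : ∀ s : ℝ, 0 < s → ‖y₁ s‖ ≤ |Λ| := by
    intro s hs
    refine abs_le_of_sq_le_sq' ?_ (abs_nonneg Λ) |>.2
    have := henergy s hs
    have : 0 ≤ Λ ^ 2 * ‖y s‖ ^ 2 := by positivity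
    rw [sq_abs]; linarith
  -- Keeping the factor `|Λ|` avoids dividing by `Λ`, which may be `0`.
  have hyle : ∀ s : ℝ, 0 < s → |Λ| * ‖y s‖ ≤ |Λ| := by
    intro s hs
    refine abs_le_of_sq_le_sq' ?_ (abs_nonneg Λ) |>.2
    have := henergy s hs
    rw [mul_pow, sq_abs]
    linarith [sq_nonneg ‖y₁ s‖]
  -- `K` is the sum of two bounds `2ρ|Λ|`: one for the excess damping times `y'`, one for the term
  -- `2iρΛ y`.
  refine norm_le_of_damped_oscillator (m := 2 * α + 1) (ρ := α + β + 1) (Λ := Λ)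
    (K := 4 * (α + β + 1) * |Λ|) (p := jacobiDamping α β)
    (f := fun s => -((jacobiDamping α β s - (2 * α + 1) / s : ℝ) * y₁ s)
      + 2 * Complex.I * (α + β + 1 : ℝ) * Λ * y s)
    hm hρ (by positivity) (fun s => (hu s).sub (hy s)) (fun s => (hu₁ s).sub (hy₁ s))
    (fun s hs => div_le_jacobiDamping hα hβ hs) ?_ ?_ ?_ ?_ hs
  · intro s hs
    refine (norm_add_le _ _).trans ?_
    have h1 := div_le_jacobiDamping hα hβ hs
    have h2 := jacobiDamping_le hα hβ hs
    have h3 : ‖-(((jacobiDamping α β s - (2 * α + 1) / s : ℝ) : ℂ) * y₁ s)‖ ≤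
        2 * (α + β + 1) * |Λ| := by
      rw [norm_neg, norm_mul, Complex.norm_of_nonneg (by linarith)]
      exact mul_le_mul (by linarith) (hy₁le s hs) (norm_nonneg _) (by linarith)
    have h4 : ‖2 * Complex.I * ((α + β + 1 : ℝ) : ℂ) * Λ * y s‖ ≤ 2 * (α + β + 1) * |Λ| := by
      have : ‖2 * Complex.I * ((α + β + 1 : ℝ) : ℂ) * Λ * y s‖ =
          2 * (α + β + 1) * (|Λ| * ‖y s‖) := by
        rw [norm_mul, norm_mul, norm_mul, norm_mul, Complex.norm_of_nonneg hρ]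
        simp; ring
      rw [this]
      exact mul_le_mul_of_nonneg_left (hyle s hs) (by linarith)
    linarith
  · intro s hs
    have hre : (-Complex.sinh s ^ 2).re < 1 / 2 := by
      rw [← Complex.ofReal_sinh, ← Complex.ofReal_pow, ← Complex.ofReal_neg, Complex.ofReal_re]
      nlinarith [sq_nonneg (Real.sinh s)]
    have h1 := jacobi_ode hs hab hκ (pfaff_ode hc hre)
    have h2 := hyode s hs
    simp only [hydef, hy₁def, Complex.ofReal_sub, Pi.sub_apply]
    linear_combination h1 - h2
  · simp [pfaff, hy0]
  · simp

theorem jacobiFunction_eq_pfaff {α β : ℝ} (hα : -1 < α) (μ : ℂ) (t : ℝ) :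
    jacobiFunction α β μ t = pfaff ((α + β + 1 - Complex.I * μ) / 2)
      ((α + β + 1 + Complex.I * μ) / 2) (α + 1) (-Complex.sinh t ^ 2) := by
  have hc : ∀ k : ℕ, (α + 1 : ℂ) + k ≠ 0 := by
    intro k
    have : (0 : ℝ) < α + 1 + k := by
      have : (0 : ℝ) ≤ k := k.cast_nonneg
      linarith
    exact_mod_cast this.ne'
  rw [jacobiFunction, gaussHypergeometric_eq (isHypergeometricContinuation_pfaff hc)]
  · push_cast; rfl
  · rw [Set.mem_ofPred_eq, ← Complex.ofReal_neg, Complex.ofReal_re]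
    nlinarith [sq_nonneg (Real.sinh t)]

theorem mainTheorem8 (α β T : ℝ) (hαβ : β ≤ α) (hβ : -(1 / 2) ≤ β) (hα : -(1 / 2) < α)
    (hT : 0 < T) :
    ∃ C : ℝ, ∀ l t n : ℝ, 0 ≤ t → t ≤ T → 1 ≤ n →
      ‖jacobiFunction α β (Complex.I * ((α + β + 1 : ℝ) : ℂ) - ((n * l : ℝ) : ℂ)) (t / n)
          - ((normalizedBessel α (l * t) : ℝ) : ℂ)‖
        ≤ C * (|l| * t ^ 2 / n) := by
  refine ⟨Real.exp ((α + β + 1) * T) * (4 * (α + β + 1)) / (2 * √(2 * α + 1)), ?_⟩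
  intro l t n ht htT hn
  have hn0 : 0 < n := by linarith
  have hρ : 0 ≤ α + β + 1 := by linarith
  have hs : 0 ≤ t / n := by positivity
  have hsT : t / n ≤ T := (div_le_self ht hn).trans htT
  have hlt : l * t = n * l * (t / n) := by field_simp
  rw [jacobiFunction_eq_pfaff (by linarith), normalizedBessel_eq_besselEntire (by linarith), hlt,
    Complex.ofReal_mul (n * l)]
  refine (norm_pfaff_sub_besselEntire_le (Λ := n * l) hβ hα (by ring) ?_ hs).trans ?_
  · push_cast
    -- Here `4ab = ρ² + μ²` with `μ = iρ - nλ`; the `ρ²` terms cancel.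
    linear_combination ((α + β + 1 : ℂ) ^ 2 - (Complex.I * (α + β + 1) - n * l) ^ 2)
      * Complex.I_sq
  · rw [abs_mul, abs_of_pos hn0]
    -- The exponential is bounded at `T`; one `n` from `Λ = nλ` against `n²` from `(t/n)²` leaves
    -- `1/n`.
    calc _ ≤ Real.exp ((α + β + 1) * T) * (4 * (α + β + 1) * (n * |l|)) * (t / n) ^ 2
          / (2 * √(2 * α + 1)) := by gcongr
      _ = _ := by field_simp
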